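/- Let $\mathcal{U}=\{u_0,u_1,u_2,\dots\}$ and let $\mathbb{Q}\langle\mathcal{U}\rangle$ be the $\mathbb{Q}$-vector space with basis the words in $\mathcal{U}$. For $\mathbf{k}=(k_1,\dots,k_r)$ write $u_{\mathbf{k}}=u_{k_1}\cdots u_{k_r}$, $|\mathbf{k}|=k_1+\cdots+k_r$, and let $\operatorname{depth}(u_{\mathbf{k}})$ be the number of $j$ with $k_j\neq 0$. The stuffle product $\ast$ is the $\mathbb{Q}$-bilinear product on $\mathbb{Q}\langle\mathcal{U}\rangle$ determined by $\mathbf{1}\ast W=W\ast\mathbf{1}=W$ and $$u_{a}V\ast u_{b}W=u_{a}(V\ast u_{b}W)+u_{b}(u_{a}V\ast W)+u_{a+b}(V\ast W)$$ for all words $V,W$ and all $a,b\ge 0$. The box product $\boxast$ is the $\mathbb{Q}$-bilinear product for which, for words $W_1,W_2$ that do not start with $u_0$, $W_1\boxast W_2$ is the part of $W_1\ast W_2$ supported on the words of depth exactly $\max\{\operatorname{depth}(W_1),\operatorname{depth}(W_2)\}$. For positive integers $z,d$ let $$S_{z,d}=\operatorname{span}_{\mathbb{Q}}\left\{u_{\mathbf{n}}\boxast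 u_{\boldsymbol{\ell}}\;\middle|\;\mathbf{n}\in\mathbb{Z}_{>0}^{s},\ \boldsymbol{\ell}\in\mathbb{Z}_{>0}^{d},\ 1\le s\le d,\ |\mathbf{n}|+|\boldsymbol{\ell}|=z+d\right\}.$$ Then for all positive integers $z$ and $d$ with $1\le d\le 8$, $$\dim_{\mathbb{Q}}S_{z,d}=\binom{z+d-1}{\min\{z,d\}-1}.$$ -/

import Mathlib

/-!
Words in the letters `u_0, u_1, u_2, …` are lists of natural numbers: the word
`u_{k_1} ⋯ u_{k_r}` is the list `[k_1, …, k_r]`, and the empty word is `[]`.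
-/

/-- The `ℚ`-vector space `ℚ⟨𝒰⟩` with basis the words in `𝒰 = {u_0, u_1, u_2, …}`. -/
abbrev WordSpace : Type := List ℕ →₀ ℚ

/-- The word `u_𝐤`, as an element of `ℚ⟨𝒰⟩`. -/
noncomputable def uWord (k : List ℕ) : WordSpace := Finsupp.single k 1

/-- Left concatenation with the letter `u_j`, extended linearly. -/
noncomputable def prependLetter (j : ℕ) : WordSpace →ₗ[ℚ] WordSpace :=
  Finsupp.lmapDomain ℚ ℚ (List.cons j)

/-- The stuffle product of two words. -/
noncomputable def stuffleWord : List ℕ → List ℕ → WordSpace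
  | [], w => uWord w
  | a :: v, [] => uWord (a :: v)
  | a :: v, b :: w =>
      prependLetter a (stuffleWord v (b :: w)) + prependLetter b (stuffleWord (a :: v) w)
        + prependLetter (a + b) (stuffleWord v w)
  termination_by v w => v.length + w.length

/-- The depth of a word: the number of its letters different from `u_0`. -/
def wordDepth (w : List ℕ) : ℕ := w.countP (fun k => k ≠ 0)

/-- The part of an element of `ℚ⟨𝒰⟩` supported on the words of depth `m`. -/
noncomputable def depthPart (m : ℕ) (x : WordSpace) : WordSpace :=
  Finsupp.filter (fun w => wordDepth w = m) x

/-- The box product of two words: the part of their stuffle product that consists of the words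
of depth `max (depth v) (depth w)`. -/
noncomputable def boxWord (v w : List ℕ) : WordSpace :=
  depthPart (max (wordDepth v) (wordDepth w)) (stuffleWord v w)

/-- The box product, extended bilinearly. (It is defined here on all of `ℚ⟨𝒰⟩`; on the subspace
spanned by the words that do not start with `u_0` it is the usual box product.) -/
noncomputable def boxProduct : WordSpace →ₗ[ℚ] WordSpace →ₗ[ℚ] WordSpace :=
  Finsupp.linearCombination ℚ fun v => Finsupp.linearCombination ℚ fun w => boxWord v w

theorem boxProduct_uWord (v w : List ℕ) : boxProduct (uWord v) (uWord w) = boxWord v w := by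
  simp [boxProduct, uWord]

/-- The pairs `(𝐧, 𝐥)` of tuples of positive integers with `1 ≤ len 𝐧 ≤ d`, `len 𝐥 = d` and
`|𝐧| + |𝐥| = z + d`. -/
def boxIndexSet (z d : ℕ) : Set (List ℕ × List ℕ) :=
  {p | (∀ k ∈ p.1, 0 < k) ∧ (∀ k ∈ p.2, 0 < k) ∧ 1 ≤ p.1.length ∧ p.1.length ≤ d ∧
    p.2.length = d ∧ p.1.sum + p.2.sum = z + d}

/-- The span of the box products `u_𝐧 ⊠ u_𝐥`, for `(𝐧, 𝐥)` in `boxIndexSet z d`. -/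
noncomputable def boxSpan (z d : ℕ) : Submodule ℚ WordSpace :=
  Submodule.span ℚ ((fun p => boxProduct (uWord p.1) (uWord p.2)) '' boxIndexSet z d)

/-!
Removing `1` from every letter of `𝐥` turns a word with `d` positive letters into a monomial in
`x_1, …, x_d`. Under this dictionary `u_𝐧 ⊠ u_𝐥` becomes the monomial of `𝐥` times the monomial
quasisymmetric polynomial `M_𝐧 (x_1, …, x_d)` (`toWords_monomial_mul_msum`): the terms of depth
exactly `d` in the stuffle product are those in which every letter of `𝐧` is absorbed by a letter
of `𝐥`. Hence `boxSpan z d` is isomorphic to the degree `z` part `I_z` of the ideal generated by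
the quasisymmetric polynomials of positive degree (`map_toWords_idealPart`), and the claim is the
theorem of Aval, Bergeron and Bergeron on the Hilbert series of this ideal.

Call an exponent `w` *transdiagonal* if `w_1 + ⋯ + w_j ≥ j` for some `j ≥ 1`.

* For every transdiagonal `w`, the ideal contains a homogeneous element with lexicographically
  leading monomial `x^w` (`exists_mem_idealPart_sub_mem_lower`). It is built one variable at a
  time from the fundamental quasisymmetric polynomials `F_α`, using the two recursions
  `F_{1β}(x, L) = x F_β(L) + F_{1β}(L)` and `F_{aβ}(x, L) = x F_{(a-1)β}(x, L) + F_{aβ}(L)` for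
  `a ≥ 2`. Hence the polynomials of degree `z` are spanned by `I_z` and the monomials that are not
  transdiagonal; there are at most `C(d+z-1, z) - C(d+z-1, z-1)` of the latter if `1 ≤ z ≤ d`, and
  none if `z ≥ d`. This bounds `dim I_z` from below.
* Iterating this decomposition, and using that products of quasisymmetric polynomials are
  quasisymmetric (`msum_mul_msum`), the space `I_z` is spanned by the products `x^ν M_α` with `ν`
  not transdiagonal and `α` a nonempty composition of `z - |ν|`. Since `k ≥ 1` has `2^(k-1)`
  compositions, for `z ≤ d` this bounds `dim I_z` from above by `C(z+d-1, z-1)`, which is also the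
  lower bound. For `z > d` the upper bound is the dimension of the space of all polynomials of
  degree `z`.
-/

namespace QSymIdeal

open MvPolynomial
open scoped Pointwise

/-! ### Quasisymmetric polynomials evaluated at a list -/

section Lists

variable {R : Type*} [CommRing R]

/-- The monomial quasisymmetric polynomial `M_α`, evaluated at the elements `x_1, …, x_d` of a list:
the sum of `x_{i_1}^{α_1} ⋯ x_{i_r}^{α_r}` over `i_1 < ⋯ < i_r`. -/
def msum : List ℕ → List R → R
  | [], _ => 1
  | _ :: _, [] => 0
  | a :: α, x :: L => x ^ a * msum α L + msum (a :: α) L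

@[simp] theorem msum_nil_left (L : List R) : msum [] L = 1 := by cases L <;> rfl
@[simp] theorem msum_cons_nil (a : ℕ) (α : List ℕ) : msum (a :: α) ([] : List R) = 0 := rfl
theorem msum_cons_cons (a : ℕ) (α : List ℕ) (x : R) (L : List R) :
    msum (a :: α) (x :: L) = x ^ a * msum α L + msum (a :: α) L := rfl

theorem msum_eq_zero {α : List ℕ} {L : List R} (h : L.length < α.length) : msum α L = 0 := by
  induction L generalizing α with
  | nil => cases α <;> simp_all
  | cons x L ih =>
    cases α with
    | nil => simp at h
    | cons a α =>
      rw [msum_cons_cons, ih (by simpa using h), ih (by simp at h ⊢; omega)]; simp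

theorem msum_mem {S : Type*} [CommRing S] [Algebra S R] (A : Subalgebra S R) (α : List ℕ)
    {L : List R} (hL : ∀ x ∈ L, x ∈ A) : msum α L ∈ A := by
  induction L generalizing α with
  | nil => cases α <;> simp [A.one_mem, A.zero_mem]
  | cons x L ih =>
    cases α with
    | nil => simp [A.one_mem]
    | cons a α =>
      rw [msum_cons_cons]
      have hL' : ∀ x ∈ L, x ∈ A := fun y hy => hL y (by simp [hy])
      exact A.add_mem (A.mul_mem (A.pow_mem (hL x (by simp)) _) (ih _ hL')) (ih _ hL')

/-- The compositions that refine `α`, each listed once. The value is meaningful only if all entries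
of `α` are positive; an entry `0` yields the empty list. -/
def refinements : List ℕ → List (List ℕ)
  | [] => [[]]
  | 0 :: _ => []
  | 1 :: β => (refinements β).map (List.cons 1)
  | (a + 2) :: β =>
      (refinements ((a + 1) :: β)).map (List.cons 1) ++
        (refinements ((a + 1) :: β)).map (List.modifyHead (· + 1))

theorem refinements_props {α γ : List ℕ} (hγ : γ ∈ refinements α) :
    (∀ a ∈ γ, 0 < a) ∧ γ.sum = α.sum ∧ (α ≠ [] → γ ≠ []) := by
  induction α using refinements.induct generalizing γ with
  | case1 => simp_all [refinements]
  | case2 => simp_all [refinements]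
  | case3 β ih =>
    simp only [refinements, List.mem_map] at hγ
    obtain ⟨δ, hδ, rfl⟩ := hγ
    have := ih hδ
    simp_all
  | case4 a β ih =>
    simp only [refinements, List.mem_map, List.mem_append] at hγ
    obtain ⟨δ, hδ, rfl⟩ | ⟨δ, hδ, rfl⟩ := hγ
    · have := ih hδ
      simp_all; omega
    · have := ih hδ
      cases δ with
      | nil => simp_all
      | cons c δ =>
        have h2 := this.2.1
        simp only [List.sum_cons] at h2
        refine ⟨?_, ?_, by simp⟩
        · simp_all
        · simp only [List.modifyHead_cons, List.sum_cons]
          omega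

/-- The fundamental quasisymmetric polynomial `F_α`, evaluated at a list: the sum of `M_γ` over the
refinements `γ` of `α`. -/
def fsum (α : List ℕ) (L : List R) : R := ((refinements α).map fun γ => msum γ L).sum

@[simp] theorem fsum_nil (L : List R) : fsum [] L = 1 := by simp [fsum, refinements]

theorem fsum_one_cons (β : List ℕ) (x : R) (L : List R) :
    fsum (1 :: β) (x :: L) = x * fsum β L + fsum (1 :: β) L := by
  simp [fsum, refinements, Function.comp_def, msum_cons_cons, List.sum_map_add,
    List.sum_map_mul_left]

theorem fsum_add_two_cons (a : ℕ) (β : List ℕ) (x : R) (L : List R) :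
    fsum ((a + 2) :: β) (x :: L) =
      x * fsum ((a + 1) :: β) (x :: L) + fsum ((a + 2) :: β) L := by
  simp only [fsum, refinements, List.map_append, List.map_map, List.sum_append,
    ← List.sum_map_mul_left, ← List.sum_map_add]
  congr 1
  refine List.map_congr_left fun γ hγ => ?_
  cases γ with
  | nil => exact absurd rfl ((refinements_props hγ).2.2 (by simp))
  | cons c δ => simp [msum_cons_cons]; ring

theorem fsum_mem {S : Type*} [CommRing S] [Algebra S R] (A : Subalgebra S R) (α : List ℕ)
    {L : List R} (hL : ∀ x ∈ L, x ∈ A) : fsum α L ∈ A := by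
  refine A.list_sum_mem fun y hy => ?_
  obtain ⟨γ, -, rfl⟩ := List.mem_map.1 hy
  exact msum_mem A γ hL

/-- The words of the stuffle product of two words, listed with multiplicity. Defined apart from
`stuffleWord` so that facts about the words that occur can be proved by list membership. -/
def quasiShuffle : List ℕ → List ℕ → List (List ℕ)
  | [], w => [w]
  | a :: v, [] => [a :: v]
  | a :: v, b :: w =>
      (quasiShuffle v (b :: w)).map (List.cons a) ++ (quasiShuffle (a :: v) w).map (List.cons b) ++
        (quasiShuffle v w).map (List.cons (a + b))
  termination_by v w => v.length + w.length

theorem quasiShuffle_nil_left (w : List ℕ) : quasiShuffle [] w = [w] := by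
  rw [quasiShuffle]

theorem quasiShuffle_cons_nil (a : ℕ) (v : List ℕ) : quasiShuffle (a :: v) [] = [a :: v] := by
  rw [quasiShuffle]

theorem quasiShuffle_cons_cons (a b : ℕ) (v w : List ℕ) :
    quasiShuffle (a :: v) (b :: w) =
      (quasiShuffle v (b :: w)).map (List.cons a) ++ (quasiShuffle (a :: v) w).map (List.cons b) ++
        (quasiShuffle v w).map (List.cons (a + b)) := by
  rw [quasiShuffle]

theorem sum_map_cons_msum (c : ℕ) (l : List (List ℕ)) (x : R) (L : List R) :
    ((l.map (List.cons c)).map fun γ => msum γ (x :: L)).sum =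
      x ^ c * (l.map fun γ => msum γ L).sum +
        ((l.map (List.cons c)).map fun γ => msum γ L).sum := by
  simp only [List.map_map, Function.comp_def, msum_cons_cons, List.sum_map_add,
    List.sum_map_mul_left]

/-- Quasisymmetric polynomials multiply by the stuffle product, so that their span is closed under
multiplication. -/
theorem msum_mul_msum (α β : List ℕ) (L : List R) :
    msum α L * msum β L = ((quasiShuffle α β).map fun γ => msum γ L).sum := by
  induction L generalizing α β with
  | nil =>
    cases α <;> cases β <;>
      simp [quasiShuffle_nil_left, quasiShuffle_cons_nil, quasiShuffle_cons_cons,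
        Function.comp_def]
  | cons x L ih =>
    rcases α with - | ⟨a, v⟩
    · simp [quasiShuffle_nil_left]
    rcases β with - | ⟨b, w⟩
    · simp [quasiShuffle_cons_nil]
    have h := ih (a :: v) (b :: w)
    rw [quasiShuffle_cons_cons, List.map_append, List.map_append, List.sum_append,
      List.sum_append] at h ⊢
    rw [sum_map_cons_msum, sum_map_cons_msum, sum_map_cons_msum, ← ih, ← ih, ← ih,
      msum_cons_cons, msum_cons_cons]
    linear_combination h

theorem quasiShuffle_props {α β γ : List ℕ} (hα : ∀ a ∈ α, 0 < a) (hβ : ∀ a ∈ β, 0 < a)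
    (hγ : γ ∈ quasiShuffle α β) :
    (∀ a ∈ γ, 0 < a) ∧ γ.sum = α.sum + β.sum := by
  induction α, β using quasiShuffle.induct generalizing γ with
  | case1 => simp_all [quasiShuffle_nil_left]
  | case2 => simp_all [quasiShuffle_cons_nil]
  | case3 a v b w ih1 ih2 ih3 =>
    simp only [List.mem_cons, forall_eq_or_imp] at hα hβ
    simp only [quasiShuffle_cons_cons, List.mem_append, List.mem_map] at hγ
    obtain (⟨δ, hδ, rfl⟩ | ⟨δ, hδ, rfl⟩) | ⟨δ, hδ, rfl⟩ := hγ
    · obtain ⟨hpos, hsum⟩ := ih1 hα.2 (by simpa using hβ) hδ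
      simp only [List.sum_cons] at hsum ⊢
      exact ⟨List.forall_mem_cons.2 ⟨by omega, hpos⟩, by omega⟩
    · obtain ⟨hpos, hsum⟩ := ih2 (by simpa using hα) hβ.2 hδ
      simp only [List.sum_cons] at hsum ⊢
      exact ⟨List.forall_mem_cons.2 ⟨by omega, hpos⟩, by omega⟩
    · obtain ⟨hpos, hsum⟩ := ih3 hα.2 hβ.2 hδ
      simp only [List.sum_cons] at hsum ⊢
      exact ⟨List.forall_mem_cons.2 ⟨by omega, hpos⟩, by omega⟩

/-- The words obtained from `w` by adding the letters of `v`, in their order, to the letters of `w`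
at distinct positions. -/
def overlay : List ℕ → List ℕ → List (List ℕ)
  | [], w => [w]
  | _ :: _, [] => []
  | a :: v, b :: w =>
      (overlay (a :: v) w).map (List.cons b) ++ (overlay v w).map (List.cons (a + b))

theorem length_of_mem_overlay {v w u : List ℕ} (hu : u ∈ overlay v w) : u.length = w.length := by
  induction v, w using overlay.induct generalizing u with
  | case1 => simp_all [overlay]
  | case2 => simp_all [overlay]
  | case3 a v b w ih1 ih2 =>
    simp only [overlay, List.mem_append, List.mem_map] at hu
    obtain ⟨δ, hδ, rfl⟩ | ⟨δ, hδ, rfl⟩ := hu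
    · simp [ih1 hδ]
    · simp [ih2 hδ]

theorem overlay_map_succ (v w : List ℕ) :
    overlay v (w.map (· + 1)) = (overlay v w).map (List.map (· + 1)) := by
  induction v, w using overlay.induct with
  | case1 => simp [overlay]
  | case2 => simp [overlay]
  | case3 a v b w ih1 ih2 =>
    simp only [List.map_cons, overlay, ih1, ih2, List.map_append, List.map_map]
    rfl

/-- The monomial `x_1^{u_1} ⋯ x_d^{u_d}` in the elements of a list. -/
def listMonomial (L : List R) (u : List ℕ) : R := (List.zipWith (· ^ ·) L u).prod

theorem listMonomial_mul_msum (L : List R) (u α : List ℕ) (h : u.length = L.length) :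
    listMonomial L u * msum α L = ((overlay α u).map (listMonomial L)).sum := by
  induction L generalizing u α with
  | nil =>
    cases α with
    | nil => simp [overlay]
    | cons a α => cases u <;> simp_all [overlay]
  | cons x L ih =>
    cases α with
    | nil => simp [overlay]
    | cons a α =>
      cases u with
      | nil => simp at h
      | cons b u =>
        have h1 := ih u α (by simpa using h)
        have h2 := ih u (a :: α) (by simpa using h)
        have hcons (c : ℕ) (u : List ℕ) :
            listMonomial (x :: L) (c :: u) = x ^ c * listMonomial L u := by simp [listMonomial]
        simp only [overlay, List.map_append, List.map_map, Function.comp_def, List.sum_append,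
          hcons, List.sum_map_mul_left, msum_cons_cons]
        rw [← h1, ← h2]
        ring

end Lists

/-! ### The box product of words with positive letters -/

section BoxWord

theorem depthPart_add (m : ℕ) (x y : WordSpace) :
    depthPart m (x + y) = depthPart m x + depthPart m y := Finsupp.filter_add

theorem prependLetter_uWord (j : ℕ) (w : List ℕ) : prependLetter j (uWord w) = uWord (j :: w) := by
  simp [prependLetter, uWord, Finsupp.lmapDomain_apply]

theorem depthPart_uWord (m : ℕ) (w : List ℕ) :
    depthPart m (uWord w) = if wordDepth w = m then uWord w else 0 := by
  unfold depthPart uWord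
  split_ifs with h
  · exact Finsupp.filter_single_of_pos _ h
  · exact Finsupp.filter_single_of_neg _ h

theorem single_eq_smul_uWord (w : List ℕ) (c : ℚ) :
    (Finsupp.single w c : WordSpace) = c • uWord w := by
  simp [uWord]

theorem depthPart_smul (m : ℕ) (c : ℚ) (x : WordSpace) :
    depthPart m (c • x) = c • depthPart m x := Finsupp.filter_smul

theorem depthPart_zero (m : ℕ) : depthPart m 0 = 0 := Finsupp.filter_zero _

theorem wordDepth_cons {j : ℕ} (hj : 0 < j) (w : List ℕ) :
    wordDepth (j :: w) = wordDepth w + 1 := by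
  simp [wordDepth, hj.ne']

theorem depthPart_prependLetter {j : ℕ} (hj : 0 < j) (m : ℕ) (x : WordSpace) :
    depthPart (m + 1) (prependLetter j x) = prependLetter j (depthPart m x) := by
  induction x using Finsupp.induction_linear with
  | zero => simp only [map_zero, depthPart_zero]
  | add x y hx hy => simp only [map_add, depthPart_add, hx, hy]
  | single w c =>
    rw [single_eq_smul_uWord, map_smul, depthPart_smul, depthPart_smul, map_smul,
      prependLetter_uWord, depthPart_uWord, depthPart_uWord, wordDepth_cons hj]
    by_cases hw : wordDepth w = m <;> simp [hw, prependLetter_uWord]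

theorem depthPart_zero_prependLetter {j : ℕ} (hj : 0 < j) (x : WordSpace) :
    depthPart 0 (prependLetter j x) = 0 := by
  induction x using Finsupp.induction_linear with
  | zero => simp only [map_zero, depthPart_zero]
  | add x y hx hy => simp only [map_add, depthPart_add, hx, hy, add_zero]
  | single w c =>
    rw [single_eq_smul_uWord, map_smul, depthPart_smul, prependLetter_uWord, depthPart_uWord,
      wordDepth_cons hj]
    simp

theorem wordDepth_eq_length {w : List ℕ} (hw : ∀ k ∈ w, 0 < k) : wordDepth w = w.length := by
  rw [wordDepth, List.countP_eq_length]
  intro k hk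
  simpa using (hw k hk).ne'

/-- Each word of `v ∗ w` arises from `w` by inserting letters or enlarging letters, so its depth is
at least the length of `w`. -/
theorem depthPart_stuffleWord_of_lt {v w : List ℕ} (hv : ∀ k ∈ v, 0 < k) (hw : ∀ k ∈ w, 0 < k)
    {m : ℕ} (hm : m < w.length) : depthPart m (stuffleWord v w) = 0 := by
  induction v, w using stuffleWord.induct generalizing m with
  | case1 w => rw [stuffleWord, depthPart_uWord, wordDepth_eq_length hw, if_neg hm.ne']
  | case2 a v => simp at hm
  | case3 a v b w ih1 ih2 ih3 =>
    have hv' := hv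
    have hw' := hw
    simp only [List.mem_cons, forall_eq_or_imp] at hv' hw'
    rw [stuffleWord, depthPart_add, depthPart_add]
    cases m with
    | zero =>
      rw [depthPart_zero_prependLetter hv'.1, depthPart_zero_prependLetter hw'.1,
        depthPart_zero_prependLetter (by omega)]
      simp
    | succ m =>
      simp only [List.length_cons] at hm ih1
      rw [depthPart_prependLetter hv'.1, depthPart_prependLetter hw'.1,
        depthPart_prependLetter (by omega), ih1 hv'.2 hw (by omega), ih2 hv hw'.2 (by omega),
        ih3 hv'.2 hw'.2 (by omega)]
      simp

theorem depthPart_length_stuffleWord {v w : List ℕ} (hv : ∀ k ∈ v, 0 < k) (hw : ∀ k ∈ w, 0 < k) :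
    depthPart w.length (stuffleWord v w) = ((overlay v w).map uWord).sum := by
  induction v, w using stuffleWord.induct with
  | case1 w => simp [stuffleWord, depthPart_uWord, wordDepth_eq_length hw, overlay]
  | case2 a v =>
    rw [stuffleWord, depthPart_uWord, wordDepth_eq_length hv]
    simp [overlay]
  | case3 a v b w ih1 ih2 ih3 =>
    have hv' := hv
    have hw' := hw
    simp only [List.mem_cons, forall_eq_or_imp] at hv' hw'
    rw [stuffleWord, depthPart_add, depthPart_add, List.length_cons,
      depthPart_prependLetter hv'.1, depthPart_prependLetter hw'.1,
      depthPart_prependLetter (by omega), ih2 hv hw'.2, ih3 hv'.2 hw'.2,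
      depthPart_stuffleWord_of_lt hv'.2 hw (by simp)]
    simp [overlay, map_list_sum, Function.comp_def, prependLetter_uWord]

theorem boxWord_eq_sum_overlay {v w : List ℕ} (hv : ∀ k ∈ v, 0 < k) (hw : ∀ k ∈ w, 0 < k)
    (h : v.length ≤ w.length) : boxWord v w = ((overlay v w).map uWord).sum := by
  rw [boxWord, wordDepth_eq_length hv, wordDepth_eq_length hw, max_eq_right h,
    depthPart_length_stuffleWord hv hw]

end BoxWord

/-! ### Leading monomials of the ideal of quasisymmetric polynomials -/

section LeadingMonomials

variable {d : ℕ}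

theorem isHomogeneous_msum {σ : Type*} {L : List (MvPolynomial σ ℚ)}
    (hL : ∀ x ∈ L, x.IsHomogeneous 1) (α : List ℕ) : (msum α L).IsHomogeneous α.sum := by
  induction L generalizing α with
  | nil =>
    cases α with
    | nil => simpa using isHomogeneous_one σ ℚ
    | cons a α => simpa using isHomogeneous_zero σ ℚ _
  | cons x L ih =>
    have hL' : ∀ x ∈ L, x.IsHomogeneous 1 := fun y hy => hL y (by simp [hy])
    cases α with
    | nil => simpa using isHomogeneous_one σ ℚ
    | cons a α =>
      rw [msum_cons_cons]
      refine .add ?_ (ih hL' _)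
      have := ((hL x (by simp)).pow a).mul (ih hL' α)
      simpa using this

/-- The list of variables `x_1, …, x_d`. -/
noncomputable def vars (d : ℕ) : List (MvPolynomial (Fin d) ℚ) := List.ofFn X

@[simp] theorem length_vars : (vars d).length = d := by simp [vars]

theorem isHomogeneous_of_mem_vars {x : MvPolynomial (Fin d) ℚ} (hx : x ∈ vars d) :
    x.IsHomogeneous 1 := by
  obtain ⟨i, rfl⟩ := (List.mem_ofFn' _ _).1 hx
  exact isHomogeneous_X _ _

theorem drop_vars {k : ℕ} (hk : k < d) :
    (vars d).drop k = X ⟨k, hk⟩ :: (vars d).drop (k + 1) := by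
  rw [List.drop_eq_getElem_cons (by simpa using hk)]
  simp [vars]

theorem mem_supported_of_mem_drop_vars {k : ℕ} {x : MvPolynomial (Fin d) ℚ}
    (hx : x ∈ (vars d).drop k) : x ∈ supported ℚ {i : Fin d | k ≤ i} := by
  obtain ⟨j, hj, rfl⟩ := List.mem_iff_getElem.1 hx
  simp [vars, X_mem_supported]

/-- The degree `z` part of the ideal generated by the quasisymmetric polynomials of positive degree
in `d` variables. -/
noncomputable def idealPart (d z : ℕ) : Submodule ℚ (MvPolynomial (Fin d) ℚ) :=
  Submodule.span ℚ {p | ∃ (m : Fin d →₀ ℕ) (α : List ℕ), α ≠ [] ∧ (∀ a ∈ α, 0 < a) ∧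
    m.degree + α.sum = z ∧ p = monomial m 1 * msum α (vars d)}

theorem idealPart_le (d z : ℕ) : idealPart d z ≤ homogeneousSubmodule (Fin d) ℚ z := by
  refine Submodule.span_le.2 ?_
  rintro _ ⟨m, α, -, -, rfl, rfl⟩
  exact (isHomogeneous_monomial _ rfl).mul
    (isHomogeneous_msum (fun _ => isHomogeneous_of_mem_vars) α)

theorem X_mul_mem_idealPart {z : ℕ} (i : Fin d) {f : MvPolynomial (Fin d) ℚ}
    (hf : f ∈ idealPart d z) : X i * f ∈ idealPart d (z + 1) := by
  induction hf using Submodule.span_induction with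
  | mem x hx =>
    obtain ⟨m, α, h1, h2, rfl, rfl⟩ := hx
    refine Submodule.subset_span ⟨Finsupp.single i 1 + m, α, h1, h2, ?_, ?_⟩
    · simp; ring
    · rw [← mul_assoc, X, monomial_mul, one_mul]
  | zero => simp
  | add x y _ _ hx hy => rw [mul_add]; exact add_mem hx hy
  | smul c x _ hx => rw [mul_smul_comm]; exact Submodule.smul_mem _ _ hx

theorem fsum_mem_idealPart {α : List ℕ} (hα : α ≠ []) :
    fsum α (vars d) ∈ idealPart d α.sum := by
  refine list_sum_mem fun y hy => ?_
  obtain ⟨γ, hγ, rfl⟩ := List.mem_map.1 hy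
  obtain ⟨h1, h2, h3⟩ := refinements_props hγ
  exact Submodule.subset_span ⟨0, γ, h3 hα, h1, by simp [h2], by simp⟩

/-- The restriction of the exponent `w` to its first `k` coordinates. -/
noncomputable def trunc (k : ℕ) (w : Fin d →₀ ℕ) : Fin d →₀ ℕ := w.filter fun i => (i : ℕ) < k

theorem trunc_zero (w : Fin d →₀ ℕ) : trunc 0 w = 0 := by
  ext i; simp [trunc]

theorem trunc_self (w : Fin d →₀ ℕ) : trunc d w = w := by
  ext i; simp [trunc]

theorem trunc_succ {k : ℕ} (hk : k < d) (w : Fin d →₀ ℕ) :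
    trunc (k + 1) w = trunc k w + Finsupp.single ⟨k, hk⟩ (w ⟨k, hk⟩) := by
  ext i
  simp only [trunc, Finsupp.filter_apply, Finsupp.add_apply, Finsupp.single_apply, Fin.ext_iff]
  have : (⟨k, hk⟩ : Fin d) = i ↔ k = i := by simp [Fin.ext_iff]
  split_ifs with h1 h2 h3 h4 h5 <;> first | omega | simp_all

theorem degree_trunc_succ {k : ℕ} (hk : k < d) (w : Fin d →₀ ℕ) :
    (trunc (k + 1) w).degree = (trunc k w).degree + w ⟨k, hk⟩ := by
  rw [trunc_succ hk]; simp

/-- An exponent is transdiagonal if `w_1 + ⋯ + w_j ≥ j` for some `1 ≤ j ≤ d`. -/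
def IsTransdiagonal (w : Fin d →₀ ℕ) : Prop :=
  ∃ j, 1 ≤ j ∧ j ≤ d ∧ j ≤ (trunc j w).degree

/-- Transdiagonality of the sequence `(w_1, …, w_k, α_1, α_2, …)`, for `α` with positive entries.
In the part beyond `k` only the last partial sum has to be tested, because `α_1 + ⋯ + α_j - j`
does not decrease with `j`. -/
def IsTransdiagonalPair (k : ℕ) (w : Fin d →₀ ℕ) (α : List ℕ) : Prop :=
  (∃ j, 1 ≤ j ∧ j ≤ k ∧ j ≤ (trunc j w).degree) ∨
    (α ≠ [] ∧ k + α.length ≤ (trunc k w).degree + α.sum)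

/-- The span of the monomials whose first `k` exponents are lexicographically smaller than those of
`w`. -/
noncomputable def lower (k : ℕ) (w : Fin d →₀ ℕ) : Submodule ℚ (MvPolynomial (Fin d) ℚ) :=
  restrictSupport ℚ {m | ∃ i : Fin d, (i : ℕ) < k ∧ m i < w i ∧ ∀ j < i, m j = w j}

theorem lower_le_succ (k : ℕ) (w : Fin d →₀ ℕ) : lower k w ≤ lower (k + 1) w :=
  restrictSupport_mono _ fun _ ⟨i, hi, h⟩ => ⟨i, by omega, h⟩

theorem lower_succ_le {k : ℕ} (hk : k < d) {w : Fin d →₀ ℕ} (hw : w ⟨k, hk⟩ = 0) :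
    lower (k + 1) w ≤ lower k w := by
  refine restrictSupport_mono _ ?_
  rintro m ⟨i, hi, h, h'⟩
  refine ⟨i, ?_, h, h'⟩
  have : (i : ℕ) ≠ k := by
    rintro rfl
    simp [hw] at h
  omega

theorem mul_mem_restrictSupport {σ : Type*} {s t : Set (σ →₀ ℕ)} {p q : MvPolynomial σ ℚ}
    {u : Set (σ →₀ ℕ)} (hp : p ∈ restrictSupport ℚ s) (hq : q ∈ restrictSupport ℚ t)
    (h : ∀ a ∈ s, ∀ b ∈ t, a + b ∈ u) : p * q ∈ restrictSupport ℚ u := by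
  have : p * q ∈ restrictSupport ℚ (s + t) := by
    rw [restrictSupport_add]; exact Submodule.mul_mem_mul hp hq
  refine restrictSupport_mono _ ?_ this
  rintro _ ⟨a, ha, b, hb, rfl⟩
  exact h a ha b hb

theorem X_mul_mem_lower {k : ℕ} (hk : k < d) {w : Fin d →₀ ℕ} {f : MvPolynomial (Fin d) ℚ}
    (hf : f ∈ lower k w) : X ⟨k, hk⟩ * f ∈ lower k w := by
  have hX : (X ⟨k, hk⟩ : MvPolynomial (Fin d) ℚ) ∈
      restrictSupport ℚ {Finsupp.single (⟨k, hk⟩ : Fin d) 1} := by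
    rw [X, monomial_mem_restrictSupport]; simp
  refine mul_mem_restrictSupport hX hf ?_
  rintro _ rfl m ⟨i, hi, h, h'⟩
  refine ⟨i, hi, ?_, fun j hj => ?_⟩
  · rw [Finsupp.add_apply, Finsupp.single_eq_of_ne (by simp [Fin.ext_iff]; omega)]
    simpa using h
  · rw [Finsupp.add_apply, Finsupp.single_eq_of_ne (by
      rw [Fin.lt_def] at hj
      rw [ne_eq, Fin.ext_iff]
      simp only
      omega)]
    simpa using h' j hj

theorem supported_le_restrictSupport {σ : Type*} {s : Set σ} {p : MvPolynomial σ ℚ}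
    (hp : p ∈ supported ℚ s) : p ∈ restrictSupport ℚ {m : σ →₀ ℕ | ∀ i ∉ s, m i = 0} := by
  rw [mem_restrictSupport_iff]
  intro m hm i hi
  by_contra hne
  exact hi (mem_supported.1 hp ((mem_vars_iff_mem_support i).2 ⟨m, hm, by simpa using hne⟩))

theorem mul_mem_lower {k : ℕ} (hk : k < d) {w : Fin d →₀ ℕ} {j : ℕ} (hj : j < w ⟨k, hk⟩)
    {q : MvPolynomial (Fin d) ℚ} (hq : q ∈ supported ℚ {i : Fin d | k + 1 ≤ i}) :
    monomial (trunc k w) 1 * (X ⟨k, hk⟩ ^ j * q) ∈ lower (k + 1) w := by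
  have h1 : (monomial (trunc k w) 1 * X ⟨k, hk⟩ ^ j : MvPolynomial (Fin d) ℚ) ∈
      restrictSupport ℚ {trunc k w + Finsupp.single (⟨k, hk⟩ : Fin d) j} := by
    rw [X_pow_eq_monomial, monomial_mul, monomial_mem_restrictSupport]; simp
  rw [← mul_assoc]
  refine mul_mem_restrictSupport h1 (supported_le_restrictSupport hq) ?_
  rintro _ rfl m hm
  simp only [Set.mem_ofPred_eq, not_le] at hm
  refine ⟨⟨k, hk⟩, by simp, ?_, fun i hi => ?_⟩
  · simpa [trunc, hm ⟨k, hk⟩ (by simp)] using hj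
  · rw [Fin.lt_def] at hi
    simp only at hi
    rw [Finsupp.add_apply, Finsupp.add_apply, hm i (by omega),
      Finsupp.single_eq_of_ne (by simp [Fin.ext_iff]; omega)]
    simp [trunc, hi]

/-- The expansion of `F_α` in powers of the first variable. The highest power has the coefficient
`F_β` in the remaining variables. -/
theorem fsum_succ_cons {R : Type*} [CommRing R] (c : ℕ) (β : List ℕ) (x : R) (L : List R) :
    fsum ((c + 1) :: β) (x :: L) =
      (∑ j ∈ Finset.range (c + 1), x ^ j * fsum ((c + 1 - j) :: β) L) + x ^ (c + 1) * fsum β L := by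
  induction c with
  | zero => simp [fsum_one_cons, add_comm]
  | succ c ih =>
    rw [fsum_add_two_cons, ih, Finset.sum_range_succ' _ (c + 1), mul_add, Finset.mul_sum]
    simp only [pow_succ', mul_assoc, Nat.add_sub_add_right, Nat.sub_zero, pow_zero, one_mul]
    ring

/-- If `(w_1, …, w_k, α)` is transdiagonal, the ideal contains an element of the form
`x_1^{w_1} ⋯ x_k^{w_k} F_α(x_{k+1}, …, x_d)` plus terms that are lexicographically lower in the
first `k` variables. If `w_{k+1} = c > 0`, the element for `(w_1, …, w_{k+1}, α)` is the one for
`(w_1, …, w_k, cα)`; if `w_{k+1} = 0`, the recursions for `F_α` express it by elements for pairs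
that are again transdiagonal. -/
theorem exists_mem_idealPart_sub_mem_lower {k : ℕ} (hk : k ≤ d) (w : Fin d →₀ ℕ) {α : List ℕ}
    (hα : ∀ a ∈ α, 0 < a) (h : IsTransdiagonalPair k w α) :
    ∃ f ∈ idealPart d ((trunc k w).degree + α.sum),
      f - monomial (trunc k w) 1 * fsum α ((vars d).drop k) ∈ lower k w := by
  induction k generalizing α with
  | zero =>
    obtain ⟨j, hj, hj', -⟩ | ⟨hne, -⟩ := h
    · omega
    · exact ⟨fsum α (vars d), by simpa [trunc_zero] using fsum_mem_idealPart hne,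
        by simp [trunc_zero]⟩
  | succ k ih =>
    replace ih := fun {α} => ih (α := α) (by omega)
    have hkd : k < d := hk
    rw [drop_vars hkd] at ih
    have hdeg := degree_trunc_succ hkd w
    have hlen (α : List ℕ) (hα : ∀ a ∈ α, 0 < a) : α.length ≤ α.sum :=
      List.length_le_sum_of_one_le _ hα
    rcases hc : w ⟨k, hkd⟩ with - | c
    · have htr : trunc (k + 1) w = trunc k w := by rw [trunc_succ hkd, hc]; simp
      -- If the prefix of length `k + 1` is transdiagonal, so is that of length `k`: `w_{k+1} = 0`.
      have hfirst : (∃ j, 1 ≤ j ∧ j ≤ k + 1 ∧ j ≤ (trunc j w).degree) →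
          ∃ j, 1 ≤ j ∧ j ≤ k ∧ j ≤ (trunc j w).degree := by
        rintro ⟨j, h1, h2, h3⟩
        rcases Nat.lt_or_ge k j with hj | hj
        · obtain rfl : j = k + 1 := by omega
          rw [htr] at h3
          refine ⟨k, ?_, le_rfl, by omega⟩
          by_contra hk0
          obtain rfl : k = 0 := by omega
          simp [trunc_zero] at h3
        · exact ⟨j, h1, hj, h3⟩
      rw [htr]
      induction α using refinements.induct with
      | case1 =>
        obtain ⟨f, hf, hf'⟩ := ih (α := []) (by simp) (.inl (hfirst (by
          rcases h with h | h
          · exact h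
          · exact absurd rfl h.1)))
        exact ⟨f, hf, lower_le_succ _ _ (by simpa using hf')⟩
      | case2 => simp at hα
      | case3 β ihα =>
        have hβ : ∀ a ∈ β, 0 < a := fun a ha => hα a (by simp [ha])
        obtain ⟨f, hf, hf'⟩ := ih hα (by
          refine h.imp hfirst fun h => ⟨by simp, ?_⟩
          have := h.2
          rw [htr] at this
          omega)
        obtain ⟨g, hg, hg'⟩ := ihα hβ (by
          rcases h with h | ⟨-, h⟩
          · exact .inl h
          · simp only [List.length_cons, List.sum_cons, htr] at h
            rcases eq_or_ne β [] with rfl | hne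
            -- For empty `β` the witness is the prefix: `w_1 + ⋯ + w_k + 1 ≥ k + 2`.
            · exact .inl ⟨k + 1, by omega, le_rfl, by rw [htr]; simp at h; omega⟩
            · exact .inr ⟨hne, by rw [htr]; omega⟩)
        refine ⟨f - X ⟨k, hkd⟩ * g, sub_mem hf ?_, ?_⟩
        · have := X_mul_mem_idealPart ⟨k, hkd⟩ hg
          rwa [List.sum_cons, add_comm 1, ← add_assoc]
        · rw [fsum_one_cons] at hf'
          have := sub_mem hf' (X_mul_mem_lower hkd (lower_succ_le hkd hc hg'))
          refine lower_le_succ _ _ ?_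
          convert this using 1
          ring
      | case4 a β ihα =>
        have hβ : ∀ b ∈ (a + 1) :: β, 0 < b := by
          simp only [List.mem_cons, forall_eq_or_imp] at hα ⊢
          exact ⟨by omega, hα.2⟩
        obtain ⟨f, hf, hf'⟩ := ih hα (by
          refine h.imp hfirst fun h => ⟨by simp, ?_⟩
          have := h.2
          rw [htr] at this
          omega)
        obtain ⟨g, hg, hg'⟩ := ih hβ (by
          refine h.imp hfirst fun h => ⟨by simp, ?_⟩
          have := h.2
          simp only [List.length_cons, List.sum_cons, htr] at this ⊢
          omega)
        refine ⟨f - X ⟨k, hkd⟩ * g, sub_mem hf ?_, ?_⟩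
        · have := X_mul_mem_idealPart ⟨k, hkd⟩ hg
          convert this using 2
          simp only [List.sum_cons]
          omega
        · rw [fsum_add_two_cons] at hf'
          have := sub_mem hf' (X_mul_mem_lower hkd hg')
          refine lower_le_succ _ _ ?_
          convert this using 1
          ring
    · obtain ⟨f, hf, hf'⟩ := ih (α := (c + 1) :: α)
        (List.forall_mem_cons.2 ⟨by omega, hα⟩) (by
          have := hlen α hα
          rcases h with ⟨j, h1, h2, h3⟩ | ⟨-, h⟩
          · rcases Nat.lt_or_ge k j with hj | hj
            -- The prefix of length `k + 1` now ends with the first entry of the composition `cα`,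
            -- and lengthening it by `α` keeps the inequality.
            · obtain rfl : j = k + 1 := by omega
              exact .inr ⟨by simp, by simp only [List.length_cons, List.sum_cons]; omega⟩
            · exact .inl ⟨j, h1, hj, h3⟩
          · exact .inr ⟨by simp, by simp only [List.length_cons, List.sum_cons]; omega⟩)
      refine ⟨f, ?_, ?_⟩
      · convert hf using 2
        simp only [List.sum_cons]
        omega
      -- The terms of `F_{cα}` in which `x_{k+1}` has exponent below `c` are lower.
      · have hsum : ∑ j ∈ Finset.range (c + 1), monomial (trunc k w) 1 * (X ⟨k, hkd⟩ ^ j *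
            fsum ((c + 1 - j) :: α) ((vars d).drop (k + 1))) ∈ lower (k + 1) w := by
          refine sum_mem fun j hj => mul_mem_lower hkd ?_ ?_
          · rw [hc]; simpa using hj
          · exact fsum_mem _ _ fun x => mem_supported_of_mem_drop_vars
        convert add_mem (lower_le_succ _ _ hf') hsum using 1
        have hm : (monomial (trunc (k + 1) w) 1 : MvPolynomial (Fin d) ℚ) =
            monomial (trunc k w) 1 * X ⟨k, hkd⟩ ^ (c + 1) := by
          rw [trunc_succ hkd, hc, X_pow_eq_monomial, monomial_mul, one_mul]
        rw [fsum_succ_cons, ← Finset.mul_sum, hm]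
        ring

/-- The span of the monomials of degree `z` that are not transdiagonal. -/
noncomputable def nonTransdiagonalSpan (d z : ℕ) : Submodule ℚ (MvPolynomial (Fin d) ℚ) :=
  restrictSupport ℚ {m | m.degree = z ∧ ¬ IsTransdiagonal m}

theorem monomial_mem_sup (m : Fin d →₀ ℕ) :
    monomial m 1 ∈ nonTransdiagonalSpan d m.degree ⊔ idealPart d m.degree := by
  induction m using (Finsupp.Lex.wellFounded_of_finite (α := Fin d) (N := ℕ) (· < ·)
    wellFounded_lt).induction with
  | _ m ih =>
  by_cases hm : IsTransdiagonal m
  · obtain ⟨f, hf, hf'⟩ := exists_mem_idealPart_sub_mem_lower (α := []) le_rfl m (by simp) (.inl hm)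
    simp only [trunc_self, List.sum_nil, add_zero, fsum_nil, mul_one] at hf hf'
    have hhom : (f - monomial m 1).IsHomogeneous m.degree :=
      .sub (idealPart_le _ _ hf) (isHomogeneous_monomial _ rfl)
    have hsub : f - monomial m 1 ∈ nonTransdiagonalSpan d m.degree ⊔ idealPart d m.degree := by
      rw [as_sum (f - monomial m 1)]
      refine sum_mem fun u hu => ?_
      obtain ⟨i, -, h1, h2⟩ := hf' hu
      have hdeg : u.degree = m.degree := by
        by_contra hne
        exact (mem_support_iff.1 hu) (hhom.coeff_eq_zero hne)
      have := ih u ⟨i, h2, h1⟩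
      rw [hdeg] at this
      rw [← mul_one (coeff u _), ← smul_eq_mul, ← smul_monomial]
      exact Submodule.smul_mem _ _ this
    rw [← sub_sub_cancel f (monomial m 1)]
    exact sub_mem (Submodule.mem_sup_right hf) hsub
  · refine Submodule.mem_sup_left ?_
    exact (monomial_mem_restrictSupport ℚ).2 (.inl ⟨rfl, hm⟩)

theorem homogeneousSubmodule_le_sup (d z : ℕ) :
    homogeneousSubmodule (Fin d) ℚ z ≤ nonTransdiagonalSpan d z ⊔ idealPart d z := by
  intro f hf
  rw [as_sum f]
  refine sum_mem fun u hu => ?_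
  have hdeg : u.degree = z := by
    by_contra hne
    exact (mem_support_iff.1 hu) (IsHomogeneous.coeff_eq_zero hf hne)
  rw [← mul_one (coeff u _), ← smul_eq_mul, ← smul_monomial, ← hdeg]
  exact Submodule.smul_mem _ _ (monomial_mem_sup u)

end LeadingMonomials

/-! ### Counting exponents that are not transdiagonal -/

section Counting

variable {d : ℕ}

theorem degree_trunc (j : ℕ) (m : Fin d →₀ ℕ) :
    (trunc j m).degree = ∑ i : Fin d, if (i : ℕ) < j then m i else 0 := by
  simp [Finsupp.degree_eq_sum, trunc, Finsupp.filter_apply]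

theorem degree_trunc_mono (j : ℕ) {m n : Fin d →₀ ℕ} (h : m ≤ n) :
    (trunc j m).degree ≤ (trunc j n).degree := by
  rw [degree_trunc, degree_trunc]
  refine Finset.sum_le_sum fun i _ => ?_
  split_ifs
  exacts [h i, le_rfl]

open Classical in
/-- The exponents of degree `z` that are not transdiagonal. -/
noncomputable def nonTransdiagonal (d z : ℕ) : Finset (Fin d →₀ ℕ) :=
  ((Finset.univ : Finset (Fin d)).finsuppAntidiag z).filter fun m => ¬ IsTransdiagonal m

theorem mem_nonTransdiagonal {z : ℕ} {m : Fin d →₀ ℕ} :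
    m ∈ nonTransdiagonal d z ↔ m.degree = z ∧ ¬ IsTransdiagonal m := by
  simp [nonTransdiagonal, Finsupp.degree_eq_sum]

theorem nonTransdiagonal_eq_empty {z : ℕ} (hd : 1 ≤ d) (h : d ≤ z) :
    nonTransdiagonal d z = ∅ := by
  refine Finset.eq_empty_of_forall_notMem fun m hm => ?_
  obtain ⟨rfl, h'⟩ := mem_nonTransdiagonal.1 hm
  exact h' ⟨d, hd, le_rfl, by rwa [trunc_self]⟩

theorem card_nonTransdiagonal_zero_le : (nonTransdiagonal d 0).card ≤ 1 := by
  classical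
  refine (Finset.card_le_card (Finset.filter_subset _ _)).trans ?_
  simp

/-- According to whether the last exponent vanishes, drop the last variable or lower its exponent
by one. -/
theorem card_nonTransdiagonal_succ_le (d z : ℕ) :
    (nonTransdiagonal (d + 1) (z + 1)).card ≤
      (nonTransdiagonal (d + 1) z).card + (nonTransdiagonal d (z + 1)).card := by
  classical
  refine (Finset.card_le_card (t := (nonTransdiagonal (d + 1) z).image
      (fun m => m + Finsupp.single (Fin.last d) 1) ∪
    (nonTransdiagonal d (z + 1)).image (Finsupp.mapDomain Fin.castSucc)) fun m hm => ?_).trans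
    ((Finset.card_union_le _ _).trans
      (add_le_add Finset.card_image_le Finset.card_image_le))
  obtain ⟨hdeg, hm⟩ := mem_nonTransdiagonal.1 hm
  rw [Finset.mem_union, Finset.mem_image, Finset.mem_image]
  rcases Nat.eq_zero_or_pos (m (Fin.last d)) with h | h
  · right
    let n : Fin d →₀ ℕ := Finsupp.equivFunOnFinite.symm fun i => m i.castSucc
    have hn : ∀ i, n i = m i.castSucc := fun i => rfl
    have htr : ∀ j, (trunc j n).degree = (trunc j m).degree := fun j => by
      rw [degree_trunc, degree_trunc, Fin.sum_univ_castSucc]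
      simp [hn, h]
    refine ⟨n, mem_nonTransdiagonal.2 ⟨?_, ?_⟩, ?_⟩
    · rw [← hdeg, Finsupp.degree_eq_sum, Finsupp.degree_eq_sum, Fin.sum_univ_castSucc]
      simp [hn, h]
    · rintro ⟨j, h1, h2, h3⟩
      exact hm ⟨j, h1, by omega, by rwa [← htr]⟩
    · ext i
      refine Fin.lastCases ?_ (fun i => ?_) i
      · rw [h, Finsupp.mapDomain_of_notMem_range _ _ (by simp)]
      · rw [Finsupp.mapDomain_apply (Fin.castSucc_injective d), hn]
  · left
    have hle : Finsupp.single (Fin.last d) 1 ≤ m := by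
      rw [Finsupp.single_le_iff]; exact h
    have hadd := tsub_add_cancel_of_le hle
    refine ⟨m - Finsupp.single (Fin.last d) 1, mem_nonTransdiagonal.2 ⟨?_, ?_⟩, hadd⟩
    · have := congrArg Finsupp.degree hadd
      rw [map_add, Finsupp.degree_single, hdeg] at this
      omega
    · rintro ⟨j, h1, h2, h3⟩
      exact hm ⟨j, h1, h2, h3.trans (degree_trunc_mono j tsub_le_self)⟩

/-- The bound of the ballot problem. -/
theorem card_nonTransdiagonal_add_choose_le {d z : ℕ} (h : z + 1 ≤ d) :
    (nonTransdiagonal d (z + 1)).card + (d + z).choose z ≤ (d + z).choose (z + 1) := by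
  induction d generalizing z with
  | zero => omega
  | succ d ihd =>
    induction z with
    | zero =>
      have h1 := card_nonTransdiagonal_succ_le d 0
      have h2 := card_nonTransdiagonal_zero_le (d := d + 1)
      rcases Nat.eq_zero_or_pos d with rfl | hd
      · rw [nonTransdiagonal_eq_empty (by omega) (by omega)]
        simp
      · have h3 := ihd (z := 0) hd
        simp at h1 h3 ⊢
        omega
    | succ z ihz =>
      have h1 := card_nonTransdiagonal_succ_le d (z + 1)
      have h2 := ihz (by omega)
      rcases Nat.lt_or_ge (z + 1) d with hd | hd
      · have h3 := ihd (z := z + 1) hd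
        have e1 : d + 1 + (z + 1) = d + 1 + z + 1 := by ring
        have e2 : d + (z + 1) = d + 1 + z := by ring
        have p1 := Nat.choose_succ_succ' (d + 1 + z) z
        have p2 := Nat.choose_succ_succ' (d + 1 + z) (z + 1)
        rw [e2] at h3
        rw [e1]
        omega
      -- On the diagonal the set is empty and the two binomial coefficients agree.
      · obtain rfl : d = z + 1 := by omega
        rw [nonTransdiagonal_eq_empty (by omega) (by omega)]
        have e : z + 1 + 1 + (z + 1) = 2 * (z + 1) + 1 := by ring
        rw [e, Finset.card_empty, zero_add, Nat.choose_symm_half]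

theorem sum_card_nonTransdiagonal_mul_le {d z : ℕ} (h : z + 1 ≤ d) :
    ∑ k ∈ Finset.range (z + 1), (nonTransdiagonal d k).card * 2 ^ (z - k) ≤
      (d + z).choose z := by
  induction z with
  | zero => simpa using card_nonTransdiagonal_zero_le
  | succ z ih =>
    have h1 := ih (by omega)
    have h2 := card_nonTransdiagonal_add_choose_le (d := d) (z := z) (by omega)
    have h3 : ∑ k ∈ Finset.range (z + 1), (nonTransdiagonal d k).card * 2 ^ (z + 1 - k) =
        2 * ∑ k ∈ Finset.range (z + 1), (nonTransdiagonal d k).card * 2 ^ (z - k) := by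
      rw [Finset.mul_sum]
      refine Finset.sum_congr rfl fun k hk => ?_
      rw [Nat.sub_add_comm (by simp at hk; omega), pow_succ]
      ring
    rw [Finset.sum_range_succ, h3]
    have p := Nat.choose_succ_succ' (d + z) z
    rw [← add_assoc d z 1, p]
    simp
    omega

end Counting

/-! ### The Hilbert function of the ideal -/

section Dimension

variable {d : ℕ}

theorem finrank_restrictSupport {σ : Type*} (s : Finset (σ →₀ ℕ)) :
    Module.finrank ℚ (restrictSupport ℚ (s : Set (σ →₀ ℕ))) = s.card := by
  rw [Module.finrank_eq_nat_card_basis (basisRestrictSupport ℚ (s : Set (σ →₀ ℕ)))]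
  simp

theorem homogeneousSubmodule_eq_restrictSupport (d z : ℕ) :
    homogeneousSubmodule (Fin d) ℚ z =
      restrictSupport ℚ
        (((Finset.univ : Finset (Fin d)).finsuppAntidiag z : Finset _) : Set _) := by
  ext p
  rw [mem_homogeneousSubmodule, mem_restrictSupport_iff]
  constructor
  · intro hp m hm
    have : m.degree = z := by
      by_contra hne
      exact (mem_support_iff.1 hm) (hp.coeff_eq_zero hne)
    simpa [Finsupp.degree_eq_sum] using this
  · intro hp m hm
    have := hp (mem_support_iff.2 hm)
    refine (DFunLike.congr_fun Finsupp.degree_eq_weight_one m).symm.trans ?_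
    simpa [Finsupp.degree_eq_sum] using this

theorem finrank_homogeneousSubmodule (d z : ℕ) :
    Module.finrank ℚ (homogeneousSubmodule (Fin d) ℚ z) = (d + z - 1).choose z := by
  rw [homogeneousSubmodule_eq_restrictSupport, finrank_restrictSupport,
    Finset.card_finsuppAntidiag_nat_eq_choose]
  simp

instance (d z : ℕ) : Module.Finite ℚ (homogeneousSubmodule (Fin d) ℚ z) :=
  Module.Finite.iff_fg.2 (homogeneousSubmodule_fg (Fin d) ℚ z)

instance (d z : ℕ) : Module.Finite ℚ (idealPart d z) :=
  Submodule.finiteDimensional_of_le (idealPart_le d z)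

theorem finrank_nonTransdiagonalSpan (d z : ℕ) :
    Module.finrank ℚ (nonTransdiagonalSpan d z) = (nonTransdiagonal d z).card := by
  rw [← finrank_restrictSupport, nonTransdiagonalSpan]
  have : {m : Fin d →₀ ℕ | m.degree = z ∧ ¬ IsTransdiagonal m} = nonTransdiagonal d z := by
    ext m
    simp [mem_nonTransdiagonal]
  rw [this]

theorem choose_le_card_add_finrank_idealPart (d z : ℕ) :
    (d + z - 1).choose z ≤ (nonTransdiagonal d z).card + Module.finrank ℚ (idealPart d z) := by
  have hle : nonTransdiagonalSpan d z ≤ homogeneousSubmodule (Fin d) ℚ z := by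
    rw [homogeneousSubmodule_eq_restrictSupport]
    refine restrictSupport_mono _ fun m hm => ?_
    simpa [Finsupp.degree_eq_sum] using hm.1
  have : Module.Finite ℚ (nonTransdiagonalSpan d z) := Submodule.finiteDimensional_of_le hle
  rw [← finrank_homogeneousSubmodule, ← finrank_nonTransdiagonalSpan]
  exact (Submodule.finrank_mono (homogeneousSubmodule_le_sup d z)).trans
    (Submodule.finrank_add_le_finrank_add_finrank _ _)

/-- The span of the products `x^ν M_α` of degree `z` with `ν` not transdiagonal and `α` a
composition, possibly empty. -/
noncomputable def standardSpan (d z : ℕ) : Submodule ℚ (MvPolynomial (Fin d) ℚ) :=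
  Submodule.span ℚ {p | ∃ (m : Fin d →₀ ℕ) (α : List ℕ), ¬ IsTransdiagonal m ∧ (∀ a ∈ α, 0 < a) ∧
    m.degree + α.sum = z ∧ p = monomial m 1 * msum α (vars d)}

/-- The span of the products `x^ν M_α` of degree `z` with `ν` not transdiagonal and `α` a nonempty
composition. -/
noncomputable def standardIdealSpan (d z : ℕ) : Submodule ℚ (MvPolynomial (Fin d) ℚ) :=
  Submodule.span ℚ {p | ∃ (m : Fin d →₀ ℕ) (α : List ℕ), ¬ IsTransdiagonal m ∧ (∀ a ∈ α, 0 < a) ∧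
    α ≠ [] ∧ m.degree + α.sum = z ∧ p = monomial m 1 * msum α (vars d)}

theorem standardIdealSpan_le (d z : ℕ) : standardIdealSpan d z ≤ standardSpan d z :=
  Submodule.span_mono fun _ ⟨m, α, h1, h2, _, h3⟩ => ⟨m, α, h1, h2, h3⟩

theorem mul_msum_mem_standardIdealSpan {z : ℕ} {f : MvPolynomial (Fin d) ℚ}
    (hf : f ∈ standardSpan d z) {β : List ℕ} (hβ : ∀ b ∈ β, 0 < b) (hne : β ≠ []) :
    f * msum β (vars d) ∈ standardIdealSpan d (z + β.sum) := by
  induction hf using Submodule.span_induction with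
  | mem x hx =>
    obtain ⟨m, α, h1, h2, rfl, rfl⟩ := hx
    rw [mul_assoc, msum_mul_msum, ← List.sum_map_mul_left]
    refine list_sum_mem fun y hy => ?_
    obtain ⟨γ, hγ, rfl⟩ := List.mem_map.1 hy
    obtain ⟨hpos, hsum⟩ := quasiShuffle_props h2 hβ hγ
    refine Submodule.subset_span ⟨m, γ, h1, hpos, ?_, by omega, rfl⟩
    rintro rfl
    have := List.length_le_sum_of_one_le β hβ
    have := List.length_pos_iff.2 hne
    simp at hsum
    omega
  | zero => simp
  | add x y _ _ hx hy => rw [add_mul]; exact add_mem hx hy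
  | smul c x _ hx => rw [smul_mul_assoc]; exact Submodule.smul_mem _ _ hx

/-- In a generator `x^m M_β` of the ideal, `x^m` has lower degree, so it is a combination of
products `x^ν M_α` with `ν` not transdiagonal, and `M_α M_β` is a combination of polynomials `M_γ`. -/
theorem homogeneousSubmodule_le_standardSpan (d z : ℕ) :
    homogeneousSubmodule (Fin d) ℚ z ≤ standardSpan d z ∧
      idealPart d z ≤ standardIdealSpan d z := by
  induction z using Nat.strong_induction_on with
  | _ z ih =>
  have hideal : idealPart d z ≤ standardIdealSpan d z := by
    refine Submodule.span_le.2 ?_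
    rintro _ ⟨m, α, hne, hα, rfl, rfl⟩
    have h1 := List.length_le_sum_of_one_le α hα
    have h2 := List.length_pos_iff.2 hne
    exact mul_msum_mem_standardIdealSpan
      ((ih m.degree (by omega)).1 (isHomogeneous_monomial _ rfl)) hα hne
  refine ⟨(homogeneousSubmodule_le_sup d z).trans (sup_le ?_
    (hideal.trans (standardIdealSpan_le d z))), hideal⟩
  rw [nonTransdiagonalSpan, restrictSupport_eq_span, Submodule.span_le]
  rintro _ ⟨m, ⟨rfl, hm⟩, rfl⟩
  exact Submodule.subset_span ⟨m, [], hm, by simp, by simp, by simp⟩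

theorem finrank_idealPart_le_sum (d z : ℕ) :
    Module.finrank ℚ (idealPart d (z + 1)) ≤
      ∑ k ∈ Finset.range (z + 1), (nonTransdiagonal d k).card * 2 ^ (z - k) := by
  let ι := Σ k : Fin (z + 1), (nonTransdiagonal d k) × Composition (z + 1 - k)
  let b : ι → MvPolynomial (Fin d) ℚ := fun x =>
    monomial x.2.1 1 * msum x.2.2.blocks (vars d)
  have hle : idealPart d (z + 1) ≤ Submodule.span ℚ (Set.range b) := by
    refine (homogeneousSubmodule_le_standardSpan d (z + 1)).2.trans (Submodule.span_mono ?_)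
    rintro _ ⟨m, α, hm, hα, hne, hsum, rfl⟩
    have h1 := List.length_le_sum_of_one_le α hα
    have h2 := List.length_pos_iff.2 hne
    exact ⟨⟨⟨m.degree, by omega⟩, ⟨m, mem_nonTransdiagonal.2 ⟨rfl, hm⟩⟩,
      ⟨α, fun {i} hi => hα i hi, by simp only; omega⟩⟩, rfl⟩
  have : Module.Finite ℚ (Submodule.span ℚ (Set.range b)) :=
    FiniteDimensional.span_of_finite ℚ (Set.finite_range b)
  refine (Submodule.finrank_mono hle).trans ((finrank_range_le_card b).trans (le_of_eq ?_))
  rw [Fintype.card_sigma, ← Fin.sum_univ_eq_sum_range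
    (fun k => (nonTransdiagonal d k).card * 2 ^ (z - k))]
  refine Finset.sum_congr rfl fun k _ => ?_
  rw [Fintype.card_prod, composition_card, Fintype.card_coe]
  congr 2
  omega

theorem finrank_idealPart {z d : ℕ} (hz : 1 ≤ z) (hd : 1 ≤ d) :
    Module.finrank ℚ (idealPart d z) = (z + d - 1).choose (min z d - 1) := by
  have hlow := choose_le_card_add_finrank_idealPart d z
  rcases le_or_gt z d with h | h
  · obtain ⟨y, rfl⟩ : ∃ y, z = y + 1 := ⟨z - 1, by omega⟩
    have h1 := card_nonTransdiagonal_add_choose_le h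
    have h2 := (finrank_idealPart_le_sum d y).trans (sum_card_nonTransdiagonal_mul_le h)
    rw [min_eq_left h]
    have e1 : y + 1 + d - 1 = d + y := by omega
    have e2 : d + (y + 1) - 1 = d + y := by omega
    rw [e1, Nat.add_sub_cancel]
    rw [e2] at hlow
    omega
  · rw [nonTransdiagonal_eq_empty hd h.le, Finset.card_empty, zero_add] at hlow
    have hup := Submodule.finrank_mono (idealPart_le d z)
    rw [finrank_homogeneousSubmodule] at hup
    rw [min_eq_right h.le, le_antisymm hup hlow, add_comm z d]
    exact Nat.choose_symm_of_eq_add (by omega)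

end Dimension

/-! ### Translation between polynomials and words -/

section Words

variable {d : ℕ}

/-- The linear map that sends the monomial with exponents `m_1, …, m_d` to the word with letters
`m_1 + 1, …, m_d + 1`. -/
noncomputable def toWords (d : ℕ) : MvPolynomial (Fin d) ℚ →ₗ[ℚ] WordSpace :=
  (basisMonomials (Fin d) ℚ).constr ℚ fun m => uWord (List.ofFn fun i => m i + 1)

theorem toWords_monomial (m : Fin d →₀ ℕ) :
    toWords d (monomial m 1) = uWord (List.ofFn fun i => m i + 1) := by
  have := (basisMonomials (Fin d) ℚ).constr_basis ℚ
    (fun m => uWord (List.ofFn fun i => m i + 1)) m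
  simpa [toWords] using this

theorem toWords_injective : Function.Injective (toWords d) := by
  refine (basisMonomials (Fin d) ℚ).injective_constr_of_linearIndependent ?_
  refine (Finsupp.linearIndependent_single_one ℚ (List ℕ)).comp
    (fun m : Fin d →₀ ℕ => List.ofFn fun i => m i + 1) fun m n h => ?_
  ext i
  simpa using congrFun (List.ofFn_injective h) i

theorem listMonomial_ofFn (m : Fin d →₀ ℕ) :
    listMonomial (vars d) (List.ofFn m) = monomial m 1 := by
  have : List.zipWith (· ^ ·) (vars d) (List.ofFn m) =
      List.ofFn fun i => (X i : MvPolynomial (Fin d) ℚ) ^ m i := by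
    apply List.ext_getElem
    · simp
    · intro i h1 h2
      simp [vars]
  rw [listMonomial, this, List.prod_ofFn, monomial_eq, Finsupp.prod_fintype _ _ (by simp)]
  simp

theorem toWords_listMonomial {u : List ℕ} (hu : u.length = d) :
    toWords d (listMonomial (vars d) u) = uWord (u.map (· + 1)) := by
  subst hu
  have h : u = List.ofFn (Finsupp.equivFunOnFinite.symm fun i => u[i] : Fin u.length →₀ ℕ) := by
    simp
  rw [congrArg (listMonomial (vars u.length)) h, listMonomial_ofFn, toWords_monomial]
  congr 1
  apply List.ext_getElem <;> simp

theorem toWords_monomial_mul_msum (m : Fin d →₀ ℕ) {α : List ℕ} (hα : ∀ a ∈ α, 0 < a)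
    (h : α.length ≤ d) :
    toWords d (monomial m 1 * msum α (vars d)) =
      boxProduct (uWord α) (uWord ((List.ofFn m).map (· + 1))) := by
  rw [boxProduct_uWord, boxWord_eq_sum_overlay hα (by simp) (by simpa using h), overlay_map_succ,
    ← listMonomial_ofFn, listMonomial_mul_msum _ _ _ (by simp), map_list_sum, List.map_map,
    List.map_map]
  congr 1
  refine List.map_congr_left fun u hu => ?_
  exact toWords_listMonomial (by simpa using length_of_mem_overlay hu)

theorem sum_map_succ (l : List ℕ) : (l.map (· + 1)).sum = l.sum + l.length := by
  induction l with
  | nil => rfl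
  | cons a l ih => simp [ih]; ring

/-- The ideal is generated by all `M_α` with `α` nonempty, while `boxSpan` uses only those of length
at most `d`; the others vanish in `d` variables. -/
theorem map_toWords_idealPart (z d : ℕ) : (idealPart d z).map (toWords d) = boxSpan z d := by
  rw [idealPart, Submodule.map_span, boxSpan]
  apply le_antisymm
  · refine Submodule.span_le.2 ?_
    rintro _ ⟨_, ⟨m, α, hne, hα, rfl, rfl⟩, rfl⟩
    rcases le_or_gt α.length d with h | h
    · rw [toWords_monomial_mul_msum m hα h]
      refine Submodule.subset_span ⟨(α, (List.ofFn m).map (· + 1)), ⟨hα, by simp,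
        List.length_pos_iff.2 hne, h, by simp, ?_⟩, rfl⟩
      simp only [sum_map_succ, List.length_ofFn, List.sum_ofFn, Finsupp.degree_eq_sum]
      ring
    · rw [msum_eq_zero (by simpa using h)]
      simp
  · refine Submodule.span_le.2 ?_
    rintro _ ⟨⟨α, l⟩, ⟨hα, hl, hlen, hlen', rfl, hsum⟩, rfl⟩
    simp only at hα hl hlen hlen' hsum ⊢
    let m : Fin l.length →₀ ℕ := Finsupp.equivFunOnFinite.symm fun i => l[i] - 1
    have hm : (List.ofFn m).map (· + 1) = l := by
      apply List.ext_getElem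
      · simp
      · intro i h1 h2
        have := hl l[i] (List.getElem_mem _)
        simp [m]
        omega
    refine Submodule.subset_span ⟨_, ⟨m, α, List.length_pos_iff.1 hlen, hα, ?_, rfl⟩, ?_⟩
    · have := sum_map_succ (List.ofFn m)
      rw [hm, List.sum_ofFn, List.length_ofFn, ← Finsupp.degree_eq_sum] at this
      omega
    · exact (toWords_monomial_mul_msum m hα hlen').trans (by rw [hm])

end Words

end QSymIdeal

theorem mainTheorem11 (z d : ℕ) (hz : 1 ≤ z) (hd : 1 ≤ d) (hd8 : d ≤ 8) :
    Module.finrank ℚ (boxSpan z d) = Nat.choose (z + d - 1) (min z d - 1) := by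
  rw [← QSymIdeal.map_toWords_idealPart, ← QSymIdeal.finrank_idealPart hz hd]
  exact (Submodule.equivMapOfInjective _ QSymIdeal.toWords_injective _).finrank_eq.symm
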